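/- Let $(\mathcal X,\mathcal A)$ be a measurable space and let $\mathcal P$ be a set of probability measures on it, dominated by a $\sigma$-finite measure $\mu$. Let $\mathcal P$ carry a $\sigma$-field and a semi-metric $d$, and let every $P\in\mathcal P$ have a $\mu$-density $p$ such that $(x,P)\mapsto p(x)$ is jointly measurable. Let $\Pi$ be a probability measure (the prior) on $\mathcal P$, let $P_0$ be a probability measure on $(\mathcal X,\mathcal A)$, not necessarily in $\mathcal P$, with $\mu$-density $p_0$, and let $P^*\in\mathcal P$. Write $Qf=\int f\,dQ$. Given $X_1,\dots,X_n$, the posterior mass of $B\subset\mathcal P$ is $$\Pi_n(B\mid X_1,\dots,X_n)=\frac{\int_B\prod_{i=1}^n p(X_i)\,d\Pi(P)}{\int_{\mathcal P}\prod_{i=1}^n p(X_i)\,d\Pi(P)}\qquad(0/0=0).$$ For $\varepsilon>0$ let (with $\log 0=-\infty$) $$B(\varepsilon,P^*;P_0)=\Big\{P\in\mathcal P:\ -P_0\log\frac{p}{p^*}\le\varepsilon^2,\ P_0\Big(\log\frac{p}{p^*}\Big)^2\le\varepsilon^2\Big\},$$ and let $N_t(\varepsilon,\mathcal P,d;P_0,P^*)$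 be the minimal number $N$ of convex sets $B_1,\dots,B_N$ of probability measures on $(\mathcal X,\mathcal A)$ that cover $\{P\in\mathcal P:\varepsilon<d(P,P^*)<2\varepsilon\}$ and satisfy, for every $i$, $$\inf_{P\in B_i}\ \sup_{0<\alpha<1}\ -\log P_0\Big(\frac{p}{p^*}\Big)^{\alpha}\ \ge\ \frac{\varepsilon^2}{4}$$ ($N_t=\infty$ if there is no such finite cover; for $P\in B_i$, $p$ is the $\mu$-density of the absolutely continuous part of $P$). **Theorem 2.1.** Assume that $-P_0\log(p^*/p_0)<\infty$ and that $P_0(p/p^*)<\infty$ for all $P\in\mathcal P$. Suppose that there are strictly positive numbers $\varepsilon_n$ with $\varepsilon_n\to0$ and $n\varepsilon_n^2\to\infty$ and a constant $L>0$ such that, for all $n\ge1$, $$\Pi\big(B(\varepsilon_n,P^*;P_0)\big)\ge e^{-Ln\varepsilon_n^2},\qquad N_t(\varepsilon,\mathcal P,d;P_0,P^*)\le e^{n\varepsilon_n^2}\ \text{ for all }\varepsilon>\varepsilon_n.$$ Then for every sufficiently large constant $M$, as $n\to\infty$, $$\Pi_n\big(P\in\mathcal P:\ d(P,P^*)\ge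 M\varepsilon_n\mid X_1,\dots,X_n\big)\to0\quad\text{in }L_1(P_0^n).$$ -/

import Mathlib

open MeasureTheory Filter Topology
open scoped ENNReal NNReal

noncomputable section

/-- The posterior mass `Π_n(B | x₁, …, xₙ) = ∫_B ∏ᵢ p(xᵢ) dΠ(P) / ∫ ∏ᵢ p(xᵢ) dΠ(P)` of a set `B`
of parameters, for a prior `prior` and densities `p`. In `ℝ≥0∞` one has `0 / 0 = 0`. -/
def posteriorMass {𝒳 Θ : Type*} [MeasurableSpace Θ] (prior : Measure Θ) (p : Θ → 𝒳 → ℝ≥0)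
    {n : ℕ} (x : Fin n → 𝒳) (B : Set Θ) : ℝ≥0∞ :=
  (∫⁻ P in B, ∏ i, (p P (x i) : ℝ≥0∞) ∂prior) / ∫⁻ P, ∏ i, (p P (x i) : ℝ≥0∞) ∂prior

/-- `P₀ (p / p*)^α`, where `p` and `p*` are the `μ`-densities of `P` and `P*`
(for a measure that `μ` does not dominate, of its absolutely continuous part). -/
def hellingerTransform {𝒳 : Type*} [MeasurableSpace 𝒳] (μ P0 Pstar P : Measure 𝒳) (α : ℝ) :
    ℝ≥0∞ :=
  ∫⁻ x, (P.rnDeriv μ x / Pstar.rnDeriv μ x) ^ α ∂P0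

/-- `inf_{P ∈ B} sup_{0 < α < 1} - log P₀ (p / p*)^α`, an extended real number. -/
def testingSeparation {𝒳 : Type*} [MeasurableSpace 𝒳] (μ P0 Pstar : Measure 𝒳)
    (B : Set (Measure 𝒳)) : EReal :=
  ⨅ P ∈ B, ⨆ α ∈ Set.Ioo (0 : ℝ) 1, -ENNReal.log (hellingerTransform μ P0 Pstar P α)

/-- `B₁, …, B_N` are convex sets of probability measures, each separated as required from `P₀`,
that cover the shell `{P ∈ 𝓜 : ε < d(P, P*) < 2ε}`. -/
structure IsTestingCover {𝒳 : Type*} [MeasurableSpace 𝒳] (μ P0 : Measure 𝒳)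
    {𝓜 : Set (Measure 𝒳)} [PseudoMetricSpace 𝓜] (Pstar : 𝓜) (ε : ℝ)
    {N : ℕ} (B : Fin N → Set (Measure 𝒳)) : Prop where
  isProbabilityMeasure : ∀ i, ∀ P ∈ B i, IsProbabilityMeasure P
  convex : ∀ i, Convex ℝ≥0 (B i)
  separated : ∀ i, ((ε ^ 2 / 4 : ℝ) : EReal) ≤ testingSeparation μ P0 Pstar (B i)
  covers : ∀ P : 𝓜, ε < dist P Pstar → dist P Pstar < 2 * ε → ∃ i, (P : Measure 𝒳) ∈ B i

/-- The covering number for testing under misspecification `N_t(ε, 𝓜, d; P₀, P*)`: the minimal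
number of sets in a testing cover, and `⊤` if there is no finite one. -/
def testingCoveringNumber {𝒳 : Type*} [MeasurableSpace 𝒳] (μ P0 : Measure 𝒳)
    {𝓜 : Set (Measure 𝒳)} [PseudoMetricSpace 𝓜] (Pstar : 𝓜) (ε : ℝ) : ℕ∞ :=
  ⨅ N ∈ {N : ℕ | ∃ B : Fin N → Set (Measure 𝒳), IsTestingCover μ P0 Pstar ε B}, (N : ℕ∞)

/-- The neighbourhood `B(ε, P*; P₀)` of those `P` with `-P₀ log (p / p*) ≤ ε²` and
`P₀ (log (p / p*))² ≤ ε²`. The first clause is the convention `log 0 = -∞` (if `p = 0` with positive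
`P₀`-probability, then both quantities are infinite); the finite second moment makes
`log (p / p*)` integrable, so that the Bochner integral is the true one. -/
def klNeighborhood {𝒳 Θ : Type*} [MeasurableSpace 𝒳] (P0 : Measure 𝒳) (p : Θ → 𝒳 → ℝ≥0)
    (Pstar : Θ) (ε : ℝ) : Set Θ :=
  {P | (∀ᵐ x ∂P0, 0 < p P x) ∧
    -∫ x, Real.log (p P x / p Pstar x) ∂P0 ≤ ε ^ 2 ∧
    ∫⁻ x, ENNReal.ofReal (Real.log (p P x / p Pstar x) ^ 2) ∂P0 ≤ ENNReal.ofReal (ε ^ 2)}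

end

/-!
The posterior mass of a set `A` is the quotient of the likelihood mass `∫_A ∏ᵢ (p / p*)(Xᵢ) dΠ` and
the evidence `∫ ∏ᵢ (p / p*)(Xᵢ) dΠ`. The evidence is rarely small: for every single `P` in the
Kullback–Leibler neighbourhood, Chebyshev's inequality bounds the probability that the likelihood
ratio is below `exp (-2 n ε²)`, and Fubini's theorem with Markov's inequality turns this into the
bound `½ exp (-(L + 2) n ε²)` for the evidence, up to probability `2 / (n ε²)`
(`measure_pi_prod_lt_le`, `measure_lintegral_lt_le`, `measure_evidence_lt_le`).

For the numerator no tests are constructed. As `min 1 y ≤ y ^ α` for `0 ≤ α ≤ 1`, it suffices to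
bound `P₀ⁿ (∫_A ∏ᵢ (p / p*)(Xᵢ) dΠ) ^ α` when `A` lies in one of the convex sets `B` of a testing
cover of a shell. Three facts give the bound `exp (-n δ² / 8)` for the shell of radius `δ`.

* Minimax (`exists_common_exponent`): separation gives each element of `B` its own exponent, but
  the affinity `P₀ (p / p*) ^ α` is concave in `p` and log-convex in `α`, and lower semicontinuous
  on all of `[0, 1]` if `0 ^ 0` is read as `0`. The good exponents of each `p` therefore form a
  compact interval; any two of these meet, by a connectedness argument along the segment between
  the two densities, hence all meet, by Helly's theorem on the line.
* Mixtures (`affinity_lintegral_le`): `B` is only convex, but the affinity bound extends from finite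
  averages to integral mixtures by the strong law of large numbers and Fatou's lemma.
* Products (`lintegral_posRpow_lintegral_prod_le`): peeling off one observation changes the mixing
  measure into an unnormalised posterior, which is again a mixing measure on `A`, so that the bounds
  multiply.

Neither the shells nor the traces of the sets `B` on the model need be measurable. Integrals over
such a set are integrals with respect to the trace of the prior on the subtype
(`exists_measure_subtype_map_eq_restrict`). Summing over the shells (`tsum_shell_le`), the entropy
bound and the lower bound for the evidence cost a factor `exp ((L + 3) n ε²)`, which the exponent
`n δ² / 8` outweighs for `δ` at least a large multiple of `ε`.
-/

section

variable {𝒳 Θ : Type*} [MeasurableSpace 𝒳] [MeasurableSpace Θ]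

/-! ### Powers with `0 ^ 0 = 0` and affinities -/

/-- The power `y ^ α` with the convention `0 ^ 0 = 0`, so that `posRpow y 0` is the indicator of
`y ≠ 0`. -/
noncomputable def posRpow (y : ℝ≥0∞) (α : ℝ) : ℝ≥0∞ := if y = 0 then 0 else y ^ α

@[simp] lemma posRpow_zero_left (α : ℝ) : posRpow 0 α = 0 := by simp [posRpow]

lemma posRpow_of_ne_zero {y : ℝ≥0∞} (hy : y ≠ 0) (α : ℝ) : posRpow y α = y ^ α := by
  simp [posRpow, hy]

lemma posRpow_of_pos {α : ℝ} (hα : 0 < α) (y : ℝ≥0∞) : posRpow y α = y ^ α := by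
  by_cases hy : y = 0 <;> simp [posRpow, hy, hα]

lemma measurable_posRpow (α : ℝ) : Measurable fun y => posRpow y α :=
  Measurable.ite (measurableSet_singleton 0) measurable_const (by fun_prop)

lemma posRpow_mul {α : ℝ} (hα : 0 ≤ α) (a b : ℝ≥0∞) :
    posRpow (a * b) α = posRpow a α * posRpow b α := by
  by_cases ha : a = 0
  · simp [ha]
  by_cases hb : b = 0
  · simp [hb]
  rw [posRpow_of_ne_zero ha, posRpow_of_ne_zero hb, posRpow_of_ne_zero (mul_ne_zero ha hb),
    ENNReal.mul_rpow_of_nonneg _ _ hα]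

lemma posRpow_le_one {α : ℝ} (hα : 0 ≤ α) {y : ℝ≥0∞} (hy : y ≤ 1) : posRpow y α ≤ 1 := by
  by_cases h0 : y = 0
  · simp [h0]
  · rw [posRpow_of_ne_zero h0]
    exact ENNReal.rpow_le_one hy hα

lemma min_one_le_posRpow {α : ℝ} (h0 : 0 ≤ α) (h1 : α ≤ 1) (y : ℝ≥0∞) :
    min 1 y ≤ posRpow y α := by
  by_cases hy : y = 0
  · simp [hy]
  rw [posRpow_of_ne_zero hy]
  rcases le_total 1 y with h | h
  · exact (min_le_left _ _).trans (by simpa using ENNReal.rpow_le_rpow h h0)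
  · exact (min_le_right _ _).trans (by simpa using ENNReal.rpow_le_rpow_of_exponent_ge h h1)

lemma posRpow_concave {α : ℝ} (h0 : 0 ≤ α) (h1 : α ≤ 1) {w v : ℝ≥0∞} (hwv : w + v = 1)
    (a b : ℝ≥0∞) : w * posRpow a α + v * posRpow b α ≤ posRpow (w * a + v * b) α := by
  rcases h0.eq_or_lt with rfl | hα
  · by_cases hc : w * a + v * b = 0
    · obtain ⟨ha, hb⟩ := add_eq_zero.1 hc
      rcases mul_eq_zero.1 ha with h | h <;> rcases mul_eq_zero.1 hb with h' | h' <;>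
        simp [h, h']
    · rw [posRpow_of_ne_zero hc, ENNReal.rpow_zero, ← hwv]
      have key : ∀ y : ℝ≥0∞, posRpow y 0 ≤ 1 := fun y => by
        by_cases hy : y = 0 <;> simp [posRpow, hy]
      exact add_le_add (mul_le_of_le_one_right' (key a)) (mul_le_of_le_one_right' (key b))
  · simp only [posRpow_of_pos hα]
    have h := ENNReal.rpow_arith_mean_le_arith_mean2_rpow w v (a ^ α) (b ^ α) hwv
      ((one_le_inv₀ hα).2 h1)
    simp only [ENNReal.rpow_rpow_inv hα.ne'] at h
    exact (ENNReal.rpow_inv_le_iff hα).1 h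

lemma posRpow_geom_mean {w v : ℝ} (hw : 0 < w) (hv : 0 < v) {a b : ℝ} (ha : 0 ≤ a) (hb : 0 ≤ b)
    (y : ℝ≥0∞) : posRpow y (w * a + v * b) = posRpow y a ^ w * posRpow y b ^ v := by
  by_cases hy : y = 0
  · simp [hy, hw]
  · simp only [posRpow_of_ne_zero hy]
    rw [ENNReal.rpow_add_of_nonneg _ _ (by positivity) (by positivity), mul_comm w, mul_comm v,
      ENNReal.rpow_mul, ENNReal.rpow_mul]

/-- Joint lower semicontinuity, which survives at the discontinuity of `0 ^ 0` because of the
convention there. -/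
lemma posRpow_le_liminf {y : ℝ≥0} {α : ℝ} {ys : ℕ → ℝ≥0} {αs : ℕ → ℝ}
    (hy : Tendsto ys atTop (𝓝 y)) (hα : Tendsto αs atTop (𝓝 α)) :
    posRpow y α ≤ liminf (fun n => posRpow (ys n) (αs n)) atTop := by
  by_cases h : y = 0
  · simp [h]
  have hne : ∀ᶠ n in atTop, ys n ≠ 0 := hy.eventually_ne h
  have hlim : Tendsto (fun n => posRpow (ys n) (αs n)) atTop (𝓝 (posRpow y α)) := by
    have h1 := (NNReal.continuousAt_rpow (Or.inl h : y ≠ 0 ∨ 0 < α)).tendsto.comp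
      (hy.prodMk_nhds hα)
    have h2 := (ENNReal.continuous_coe.tendsto _).comp h1
    rw [posRpow_of_ne_zero (by simpa using h), ← ENNReal.coe_rpow_of_ne_zero h]
    refine h2.congr' ?_
    filter_upwards [hne] with n hn
    simp [posRpow, hn, ENNReal.coe_rpow_of_ne_zero hn]
  exact hlim.liminf_eq.ge

/-- The affinity `P₀ u ^ α` of a likelihood ratio `u`, where `0 ^ 0 = 0`. -/
noncomputable def affinity (P0 : Measure 𝒳) (u : 𝒳 → ℝ≥0∞) (α : ℝ) : ℝ≥0∞ :=
  ∫⁻ x, posRpow (u x) α ∂P0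

lemma affinity_congr {P0 : Measure 𝒳} {u v : 𝒳 → ℝ≥0∞} (h : u =ᵐ[P0] v) (α : ℝ) :
    affinity P0 u α = affinity P0 v α :=
  lintegral_congr_ae (h.mono fun x hx => by simp only [hx])

lemma affinity_le_liminf {P0 : Measure 𝒳} {u : 𝒳 → ℝ≥0} {us : ℕ → 𝒳 → ℝ≥0}
    (hus : ∀ n, Measurable (us n)) {α : ℝ} {αs : ℕ → ℝ}
    (hu : ∀ᵐ x ∂P0, Tendsto (fun n => us n x) atTop (𝓝 (u x))) (hα : Tendsto αs atTop (𝓝 α)) :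
    affinity P0 (fun x => u x) α ≤ liminf (fun n => affinity P0 (fun x => us n x) (αs n)) atTop :=
  (lintegral_mono_ae (hu.mono fun _ hx => posRpow_le_liminf hx hα)).trans
    (lintegral_liminf_le fun n =>
      (measurable_posRpow _).comp (measurable_coe_nnreal_ennreal.comp (hus n)))

lemma affinity_le_of_tendsto {P0 : Measure 𝒳} {u : 𝒳 → ℝ≥0} {us : ℕ → 𝒳 → ℝ≥0}
    (hus : ∀ n, Measurable (us n)) {α : ℝ} {αs : ℕ → ℝ}
    (hu : ∀ᵐ x ∂P0, Tendsto (fun n => us n x) atTop (𝓝 (u x))) (hα : Tendsto αs atTop (𝓝 α))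
    {t : ℝ≥0∞} (ht : ∀ n, affinity P0 (fun x => us n x) (αs n) ≤ t) :
    affinity P0 (fun x => u x) α ≤ t :=
  (affinity_le_liminf hus hu hα).trans
    ((liminf_le_liminf (Eventually.of_forall ht)).trans (liminf_const t).le)

lemma affinity_concave {P0 : Measure 𝒳} {α : ℝ} (h0 : 0 ≤ α) (h1 : α ≤ 1) {w v : ℝ≥0∞}
    (hwv : w + v = 1) {a b : 𝒳 → ℝ≥0∞} (ha : Measurable a) (hb : Measurable b) :
    w * affinity P0 a α + v * affinity P0 b α ≤ affinity P0 (fun x => w * a x + v * b x) α := by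
  have ma : Measurable fun x => posRpow (a x) α := (measurable_posRpow α).comp ha
  have mb : Measurable fun x => posRpow (b x) α := (measurable_posRpow α).comp hb
  unfold affinity
  rw [← lintegral_const_mul _ ma, ← lintegral_const_mul _ mb,
    ← lintegral_add_left (ma.const_mul w)]
  exact lintegral_mono fun x => posRpow_concave h0 h1 hwv _ _

/-- The affinity is log-convex in the exponent, by Hölder's inequality. -/
lemma affinity_le_of_mem_segment {P0 : Measure 𝒳} {u : 𝒳 → ℝ≥0∞} (hu : Measurable u) {a b : ℝ}
    (ha : 0 ≤ a) (hb : 0 ≤ b) {t : ℝ≥0∞} (hta : affinity P0 u a ≤ t) (htb : affinity P0 u b ≤ t)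
    {w v : ℝ} (hw : 0 < w) (hv : 0 < v) (hwv : w + v = 1) :
    affinity P0 u (w * a + v * b) ≤ t := by
  calc affinity P0 u (w * a + v * b)
      = ∫⁻ x, posRpow (u x) a ^ w * posRpow (u x) b ^ v ∂P0 := by
        simp only [affinity, posRpow_geom_mean hw hv ha hb]
    _ ≤ affinity P0 u a ^ w * affinity P0 u b ^ v :=
        ENNReal.lintegral_mul_norm_pow_le ((measurable_posRpow a).comp hu).aemeasurable
          ((measurable_posRpow b).comp hu).aemeasurable hw.le hv.le hwv
    _ ≤ t ^ w * t ^ v := by gcongr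
    _ = t := by rw [← ENNReal.rpow_add_of_nonneg _ _ hw.le hv.le, hwv, ENNReal.rpow_one]

/-! ### Minimax over the exponent -/

/-- The exponents in `[0, 1]` at which the affinity of `u` is at most `t`. -/
def goodExponents (P0 : Measure 𝒳) (t : ℝ≥0∞) (u : 𝒳 → ℝ≥0) : Set ℝ :=
  {α | α ∈ Set.Icc (0 : ℝ) 1 ∧ affinity P0 (fun x => u x) α ≤ t}

lemma convex_goodExponents (P0 : Measure 𝒳) (t : ℝ≥0∞) {u : 𝒳 → ℝ≥0} (hu : Measurable u) :
    Convex ℝ (goodExponents P0 t u) := by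
  rw [convex_iff_forall_pos]
  rintro a ⟨ha, hta⟩ b ⟨hb, htb⟩ w v hw hv hwv
  exact ⟨convex_Icc 0 1 ha hb hw.le hv.le hwv,
    affinity_le_of_mem_segment hu.coe_nnreal_ennreal ha.1 hb.1 hta htb hw hv hwv⟩

lemma isCompact_goodExponents (P0 : Measure 𝒳) (t : ℝ≥0∞) {u : 𝒳 → ℝ≥0} (hu : Measurable u) :
    IsCompact (goodExponents P0 t u) := by
  refine isCompact_Icc.of_isClosed_subset (IsSeqClosed.isClosed ?_) fun α h => h.1
  intro αs α hαs hα
  exact ⟨isClosed_Icc.mem_of_tendsto hα (Eventually.of_forall fun n => (hαs n).1),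
    affinity_le_of_tendsto (fun _ => hu) (ae_of_all _ fun _ => tendsto_const_nhds) hα
      fun n => (hαs n).2⟩

/-- The convex combination `s u + (1 - s) v`, for a real number `s` (clamped to nonnegative
weights). -/
noncomputable def mixture (u v : 𝒳 → ℝ≥0) (s : ℝ) (x : 𝒳) : ℝ≥0 :=
  s.toNNReal * u x + (1 - s).toNNReal * v x

lemma measurable_mixture {u v : 𝒳 → ℝ≥0} (hu : Measurable u) (hv : Measurable v) (s : ℝ) :
    Measurable (mixture u v s) := by
  unfold mixture; fun_prop

lemma isClosed_setOf_mixture (P0 : Measure 𝒳) (t : ℝ≥0∞) {u v : 𝒳 → ℝ≥0} (hu : Measurable u)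
    (hv : Measurable v) {C : Set ℝ} (hC : IsCompact C) :
    IsClosed {s : ℝ | (goodExponents P0 t (mixture u v s) ∩ C).Nonempty} := by
  refine IsSeqClosed.isClosed ?_
  intro ss s hss hs
  choose αs hαs using hss
  obtain ⟨α, hαC, φ, hφ, hα⟩ := hC.tendsto_subseq fun n => (hαs n).2
  refine ⟨α, ⟨isClosed_Icc.mem_of_tendsto hα (Eventually.of_forall fun n => (hαs _).1.1), ?_⟩, hαC⟩
  refine affinity_le_of_tendsto (us := fun n => mixture u v (ss (φ n)))
    (fun _ => measurable_mixture hu hv _) (ae_of_all _ fun x => ?_) hα fun n => (hαs (φ n)).1.2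
  have hcont : Continuous fun s : ℝ => mixture u v s x := by
    unfold mixture
    exact ((continuous_real_toNNReal.mul continuous_const).add
      ((continuous_real_toNNReal.comp (by fun_prop)).mul continuous_const))
  exact (hcont.tendsto s).comp (hs.comp hφ.tendsto_atTop)

/-- Two ratios all of whose mixtures have a good exponent have one in common: by concavity, the
good exponents of a mixture are good for one of the two, and both alternatives are closed in the
mixing weight and occur, so that by connectedness they occur together. -/
lemma goodExponents_inter_nonempty {P0 : Measure 𝒳} {t : ℝ≥0∞} {u v : 𝒳 → ℝ≥0}
    (hu : Measurable u) (hv : Measurable v)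
    (h : ∀ s ∈ Set.Icc (0 : ℝ) 1, (goodExponents P0 t (mixture u v s)).Nonempty) :
    (goodExponents P0 t u ∩ goodExponents P0 t v).Nonempty := by
  -- An exponent that is bad for `u` and for `v` is bad for their mixtures, by concavity.
  have hsub : ∀ s ∈ Set.Icc (0 : ℝ) 1,
      goodExponents P0 t (mixture u v s) ⊆ goodExponents P0 t u ∪ goodExponents P0 t v := by
    rintro s ⟨hs0, hs1⟩ α ⟨hα, hle⟩
    by_contra hcon
    simp only [Set.mem_union, goodExponents, Set.mem_ofPred_eq, hα, true_and, not_or,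
      not_le] at hcon
    have hsum : s.toNNReal + (1 - s).toNNReal = 1 := by
      rw [← Real.toNNReal_add hs0 (by linarith)]; simp
    have hsum' : (s.toNNReal : ℝ≥0∞) + ((1 - s).toNNReal : ℝ≥0∞) = 1 := by exact_mod_cast hsum
    have hconc := affinity_concave (P0 := P0) hα.1 hα.2 hsum' hu.coe_nnreal_ennreal
      hv.coe_nnreal_ennreal
    have hmix : affinity P0 (fun x => s.toNNReal * (u x : ℝ≥0∞) + (1 - s).toNNReal * (v x : ℝ≥0∞)) α
        ≤ t := by
      simpa only [mixture, ENNReal.coe_add, ENNReal.coe_mul] using hle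
    have hm : t < min (affinity P0 (fun x => u x) α) (affinity P0 (fun x => v x) α) :=
      lt_min hcon.1 hcon.2
    refine (lt_irrefl t) (hm.trans_le (le_trans ?_ (hconc.trans hmix)))
    conv_lhs => rw [← one_mul (min _ _), ← hsum', add_mul]
    gcongr
    · exact min_le_left _ _
    · exact min_le_right _ _
  have hconn := isPreconnected_closed_iff.1 (isPreconnected_Icc (a := (0 : ℝ)) (b := 1)) _ _
    (isClosed_setOf_mixture P0 t hu hv (isCompact_goodExponents P0 t hu))
    (isClosed_setOf_mixture P0 t hu hv (isCompact_goodExponents P0 t hv))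
    (fun s hs => by
      obtain ⟨α, hα⟩ := h s hs
      exact (hsub s hs hα).imp (fun h' => ⟨α, hα, h'⟩) fun h' => ⟨α, hα, h'⟩)
    ⟨1, by simp, by
      have : mixture u v 1 = u := by ext; simp [mixture]
      simpa [this] using h 1 (by simp)⟩
    ⟨0, by simp, by
      have : mixture u v 0 = v := by ext; simp [mixture]
      simpa [this] using h 0 (by simp)⟩
  obtain ⟨s, hs, h1, h2⟩ := hconn
  obtain ⟨α, -, hα⟩ := isPreconnected_closed_iff.1
    (convex_goodExponents P0 t (measurable_mixture hu hv s)).isPreconnected _ _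
    (isCompact_goodExponents P0 t hu).isClosed (isCompact_goodExponents P0 t hv).isClosed
    (hsub s hs) h1 h2
  exact ⟨α, hα⟩

/-- Minimax for the affinity: in a convex set of likelihood ratios, exponents that depend on the
ratio can be replaced by a single one. -/
lemma exists_common_exponent {P0 : Measure 𝒳} {t : ℝ≥0∞} {U : Set (𝒳 → ℝ≥0)}
    (hU : Convex ℝ≥0 U) (hmeas : ∀ u ∈ U, Measurable u)
    (h : ∀ u ∈ U, (goodExponents P0 t u).Nonempty) :
    ∃ α ∈ Set.Icc (0 : ℝ) 1, ∀ u ∈ U, affinity P0 (fun x => u x) α ≤ t := by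
  classical
  rcases U.eq_empty_or_nonempty with rfl | ⟨u₀, hu₀⟩
  · exact ⟨0, by simp, by simp⟩
  have hpair : ∀ u ∈ U, ∀ v ∈ U, (goodExponents P0 t u ∩ goodExponents P0 t v).Nonempty := by
    intro u hu v hv
    refine goodExponents_inter_nonempty (hmeas u hu) (hmeas v hv) fun s hs => h _ ?_
    refine hU hu hv zero_le zero_le ?_
    rw [← Real.toNNReal_add hs.1 (by linarith [hs.2])]; simp
  obtain ⟨α, hα⟩ := Convex.helly_theorem_compact' (𝕜 := ℝ) (E := ℝ)
    (F := fun u : U => goodExponents P0 t u)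
    (fun u => convex_goodExponents P0 t (hmeas u u.2))
    (fun u => isCompact_goodExponents P0 t (hmeas u u.2)) (by
      intro I hI
      rw [Module.finrank_self] at hI
      rcases I.eq_empty_or_nonempty with rfl | ⟨a, ha⟩
      · simp
      rcases (I.erase a).eq_empty_or_nonempty with he | ⟨b, hb⟩
      · obtain ⟨α, hα⟩ := h a a.2
        refine ⟨α, Set.mem_iInter₂.2 fun i hi => ?_⟩
        by_cases hia : i = a
        · exact hia ▸ hα
        · exact absurd (Finset.mem_erase.2 ⟨hia, hi⟩) (by simp [he])
      · obtain ⟨α, hαa, hαb⟩ := hpair a a.2 b b.2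
        refine ⟨α, Set.mem_iInter₂.2 fun i hi => ?_⟩
        by_cases hia : i = a
        · exact hia ▸ hαa
        · have hcard : (I.erase a).card ≤ 1 := by rw [Finset.card_erase_of_mem ha]; omega
          rw [Finset.card_le_one.1 hcard i (Finset.mem_erase.2 ⟨hia, hi⟩) b hb]
          exact hαb)
  rw [Set.mem_iInter] at hα
  exact ⟨α, (hα ⟨u₀, hu₀⟩).1, fun u hu => (hα ⟨u, hu⟩).2⟩

/-! ### Integral mixtures of likelihood ratios -/

/-- Averages of `f` along an i.i.d. sample from `τ` converge to `∫ f dτ`. -/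
lemma ae_tendsto_average (τ : Measure Θ) [IsProbabilityMeasure τ] {f : Θ → ℝ≥0}
    (hf : Measurable f) (hfin : ∫⁻ θ, f θ ∂τ < ⊤) :
    ∀ᵐ ω ∂(Measure.infinitePi fun _ : ℕ => τ),
      Tendsto (fun n : ℕ => ((n + 1 : ℕ) : ℝ≥0)⁻¹ * ∑ i ∈ Finset.range (n + 1), f (ω i)) atTop
        (𝓝 (∫⁻ θ, f θ ∂τ).toNNReal) := by
  set ν := Measure.infinitePi fun _ : ℕ => τ
  have hfr : Measurable fun θ => (f θ : ℝ) := hf.coe_nnreal_real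
  have hint : Integrable (fun θ => (f θ : ℝ)) τ := by
    refine ⟨hfr.aestronglyMeasurable, ?_⟩
    simpa [HasFiniteIntegral] using hfin
  have hmp : ∀ i, MeasurePreserving (Function.eval i) ν τ :=
    fun i => measurePreserving_eval_infinitePi (fun _ : ℕ => τ) i
  have hslln := ProbabilityTheory.strong_law_ae_real (μ := ν)
    (fun i (ω : ℕ → Θ) => (f (ω i) : ℝ)) ((hmp 0).integrable_comp_of_integrable hint)
    (fun i j hij => (ProbabilityTheory.iIndepFun_infinitePi (P := fun _ : ℕ => τ)
      (X := fun _ θ => (f θ : ℝ)) fun _ => hfr).indepFun hij)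
    (fun i => ⟨(hfr.comp (measurable_pi_apply i)).aemeasurable,
      (hfr.comp (measurable_pi_apply 0)).aemeasurable, by
        have h1 := Measure.map_map (μ := ν) hfr (measurable_pi_apply (X := fun _ : ℕ => Θ) i)
        have h2 := Measure.map_map (μ := ν) hfr (measurable_pi_apply (X := fun _ : ℕ => Θ) 0)
        exact h1.symm.trans ((congrArg (Measure.map _)
          ((hmp i).map_eq.trans (hmp 0).map_eq.symm)).trans h2)⟩)
  have hmean : ∫ ω, (f (ω 0) : ℝ) ∂ν = (∫⁻ θ, f θ ∂τ).toReal := by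
    have h1 : ∫ ω, (f (ω 0) : ℝ) ∂ν = ∫ θ, (f θ : ℝ) ∂τ := by
      rw [← (hmp 0).map_eq, integral_map (measurable_pi_apply 0).aemeasurable
        hfr.aestronglyMeasurable]
    rw [h1, integral_eq_lintegral_of_nonneg_ae (ae_of_all _ fun _ => NNReal.coe_nonneg _)
      hfr.aestronglyMeasurable]
    simp
  filter_upwards [hslln] with ω hω
  rw [hmean] at hω
  rw [← NNReal.tendsto_coe]
  refine (hω.comp (tendsto_add_atTop_nat 1)).congr fun n => ?_
  simp [div_eq_inv_mul]

/-- A bound on the affinities of finite averages extends to integral mixtures: the mixture is a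
limit of averages over an i.i.d. sample of parameters, and Fatou's lemma applies. -/
lemma affinity_lintegral_le {P0 : Measure 𝒳} [SFinite P0] (τ : Measure Θ) [IsProbabilityMeasure τ]
    {q : Θ → 𝒳 → ℝ≥0} (hq : Measurable fun z : Θ × 𝒳 => q z.1 z.2)
    (hfin : ∀ᵐ x ∂P0, ∫⁻ θ, q θ x ∂τ < ⊤) {α : ℝ} {t : ℝ≥0∞}
    (havg : ∀ (n : ℕ) (ω : ℕ → Θ), affinity P0
      (fun x => ((((n + 1 : ℕ) : ℝ≥0)⁻¹ * ∑ i ∈ Finset.range (n + 1), q (ω i) x : ℝ≥0) : ℝ≥0∞)) α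
        ≤ t) :
    affinity P0 (fun x => ∫⁻ θ, q θ x ∂τ) α ≤ t := by
  set ν := Measure.infinitePi fun _ : ℕ => τ
  have hmeas : ∀ n : ℕ, Measurable fun z : 𝒳 × (ℕ → Θ) =>
      ((n + 1 : ℕ) : ℝ≥0)⁻¹ * ∑ i ∈ Finset.range (n + 1), q (z.2 i) z.1 := fun n =>
    (Finset.measurable_sum _ fun i _ => hq.comp
      (((measurable_pi_apply i).comp measurable_snd).prodMk measurable_fst)).const_mul _
  have hg : Measurable fun z : 𝒳 × (ℕ → Θ) => (∫⁻ θ, q θ z.1 ∂τ).toNNReal := by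
    have : Measurable fun x : 𝒳 => ∫⁻ θ, q θ x ∂τ := hq.coe_nnreal_ennreal.lintegral_prod_left'
    exact this.ennreal_toNNReal.comp measurable_fst
  have hae : ∀ᵐ x ∂P0, ∀ᵐ ω ∂ν, Tendsto (fun n : ℕ => ((n + 1 : ℕ) : ℝ≥0)⁻¹ *
      ∑ i ∈ Finset.range (n + 1), q (ω i) x) atTop (𝓝 (∫⁻ θ, q θ x ∂τ).toNNReal) := by
    filter_upwards [hfin] with x hx
    exact ae_tendsto_average τ (hq.comp (measurable_id.prodMk measurable_const)) hx
  rw [Measure.ae_ae_comm (measurableSet_tendsto_fun hmeas hg)] at hae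
  obtain ⟨ω, hω⟩ := hae.exists
  rw [affinity_congr (v := fun x => ((∫⁻ θ, q θ x ∂τ).toNNReal : ℝ≥0∞))
    (hfin.mono fun x hx => (ENNReal.coe_toNNReal hx.ne).symm)]
  exact affinity_le_of_tendsto (fun n => (hmeas n).comp (measurable_id.prodMk measurable_const))
    hω tendsto_const_nhds fun n => havg n ω

/-! ### Products of observations and traces of measures -/

lemma measurable_prod_coe {n : ℕ} {q : Θ → 𝒳 → ℝ≥0}
    (hq : Measurable fun z : Θ × 𝒳 => q z.1 z.2) :
    Measurable fun z : Θ × (Fin n → 𝒳) => ∏ i, (q z.1 (z.2 i) : ℝ≥0∞) :=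
  Finset.measurable_prod _ fun i _ => (hq.comp
    (measurable_fst.prodMk ((measurable_pi_apply i).comp measurable_snd))).coe_nnreal_ennreal

lemma measurable_lintegral_prod {n : ℕ} (τ : Measure Θ) [SFinite τ] {q : Θ → 𝒳 → ℝ≥0}
    (hq : Measurable fun z : Θ × 𝒳 => q z.1 z.2) :
    Measurable fun x : Fin n → 𝒳 => ∫⁻ θ, ∏ i, (q θ (x i) : ℝ≥0∞) ∂τ :=
  (measurable_prod_coe hq).lintegral_prod_left'

lemma lintegral_pi_succ (P0 : Measure 𝒳) [SigmaFinite P0] {n : ℕ} {f : (Fin (n + 1) → 𝒳) → ℝ≥0∞}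
    (hf : Measurable f) :
    ∫⁻ x, f x ∂(Measure.pi fun _ => P0) =
      ∫⁻ a, ∫⁻ x, f (Fin.cons a x) ∂(Measure.pi fun _ : Fin n => P0) ∂P0 := by
  have hmp := (measurePreserving_piFinSuccAbove (fun _ : Fin (n + 1) => P0) 0).symm
  rw [← hmp.lintegral_comp hf, lintegral_prod]
  · simp [MeasurableEquiv.piFinSuccAbove, Fin.insertNthEquiv]
  · exact (hf.comp hmp.measurable).aemeasurable

/-- Affinity bounds multiply over independent observations. The first observation `a` turns the
mixing measure `τ` into the unnormalised posterior `q(·, a) τ`, to which the bound for the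
remaining observations applies. -/
lemma lintegral_posRpow_lintegral_prod_le {P0 : Measure 𝒳} [IsProbabilityMeasure P0]
    {q : Θ → 𝒳 → ℝ≥0} (hq : Measurable fun z : Θ × 𝒳 => q z.1 z.2) {α : ℝ} {t : ℝ≥0∞}
    (hfin : ∀ (τ : Measure Θ) [IsFiniteMeasure τ], ∀ᵐ x ∂P0, ∫⁻ θ, q θ x ∂τ < ⊤)
    (hstep : ∀ (τ : Measure Θ) [IsFiniteMeasure τ],
      affinity P0 (fun x => ∫⁻ θ, q θ x ∂τ) α ≤ t * posRpow (τ Set.univ) α)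
    (n : ℕ) (τ : Measure Θ) [IsFiniteMeasure τ] :
    ∫⁻ x : Fin n → 𝒳, posRpow (∫⁻ θ, ∏ i, (q θ (x i) : ℝ≥0∞) ∂τ) α ∂(Measure.pi fun _ => P0)
      ≤ t ^ n * posRpow (τ Set.univ) α := by
  induction n generalizing τ with
  | zero => simp
  | succ n ih =>
    have hqa : ∀ a, Measurable fun θ => (q θ a : ℝ≥0∞) := fun a =>
      (hq.comp (measurable_id.prodMk measurable_const)).coe_nnreal_ennreal
    have hm : Measurable fun x : Fin (n + 1) → 𝒳 =>
        posRpow (∫⁻ θ, ∏ i, (q θ (x i) : ℝ≥0∞) ∂τ) α :=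
      (measurable_posRpow α).comp (measurable_lintegral_prod τ hq)
    rw [lintegral_pi_succ _ hm]
    calc ∫⁻ a, ∫⁻ x : Fin n → 𝒳,
          posRpow (∫⁻ θ, ∏ i, (q θ (Fin.cons (α := fun _ => 𝒳) a x i) : ℝ≥0∞) ∂τ) α
            ∂(Measure.pi fun _ => P0) ∂P0
        ≤ ∫⁻ a, t ^ n * posRpow (∫⁻ θ, q θ a ∂τ) α ∂P0 := by
          refine lintegral_mono_ae ((hfin τ).mono fun a ha => ?_)
          have : IsFiniteMeasure (τ.withDensity fun θ => (q θ a : ℝ≥0∞)) :=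
            isFiniteMeasure_withDensity ha.ne
          have h := ih (τ.withDensity fun θ => (q θ a : ℝ≥0∞))
          rw [withDensity_apply _ MeasurableSet.univ, Measure.restrict_univ] at h
          refine le_trans (le_of_eq (lintegral_congr fun x => ?_)) h
          have hx : Measurable fun θ => ∏ i, (q θ (x i) : ℝ≥0∞) :=
            (measurable_prod_coe hq).comp (measurable_id.prodMk measurable_const)
          rw [lintegral_withDensity_eq_lintegral_mul _ (hqa a) hx]
          simp [Fin.prod_univ_succ]
      _ = t ^ n * affinity P0 (fun x => ∫⁻ θ, q θ x ∂τ) α := by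
          exact lintegral_const_mul _ ((measurable_posRpow α).comp
            hq.coe_nnreal_ennreal.lintegral_prod_left')
      _ ≤ t ^ n * (t * posRpow (τ Set.univ) α) := by gcongr; exact hstep τ
      _ = t ^ (n + 1) * posRpow (τ Set.univ) α := by ring

/-- The trace of a measure on an arbitrary subset `A`, measurable or not: by Carathéodory's
criterion the outer measure of `ν` restricts to a measure on the subtype. -/
lemma exists_measure_subtype_map_eq_restrict (ν : Measure Θ) (A : Set Θ) :
    ∃ τ : Measure A, τ.map Subtype.val = ν.restrict A := by
  refine ⟨(OuterMeasure.comap Subtype.val ν.toOuterMeasure).toMeasure ?_, ?_⟩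
  · rintro _ ⟨E, hE, rfl⟩ T
    simp only [OuterMeasure.comap_apply]
    rw [Set.image_inter_preimage, Set.image_sdiff_preimage]
    exact (measure_inter_add_sdiff _ hE).symm
  · ext E hE
    rw [Measure.map_apply measurable_subtype_coe hE,
      toMeasure_apply _ _ (measurable_subtype_coe hE), Measure.restrict_apply hE]
    simp [OuterMeasure.comap_apply, Set.inter_comm]

/-! ### Lower bounds for the evidence -/

/-- Chebyshev's inequality for the log-likelihood ratio: its mean is at least `-n e` and its
variance at most `n e`. -/
lemma measure_pi_prod_lt_le {P0 : Measure 𝒳} [IsProbabilityMeasure P0] {f : 𝒳 → ℝ≥0}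
    (hf : Measurable f) (hpos : ∀ᵐ x ∂P0, 0 < f x) {e : ℝ} (he : 0 < e)
    (hmean : -∫ x, Real.log (f x) ∂P0 ≤ e)
    (hsq : ∫⁻ x, ENNReal.ofReal (Real.log (f x) ^ 2) ∂P0 ≤ ENNReal.ofReal e) {n : ℕ} (hn : 1 ≤ n) :
    Measure.pi (fun _ : Fin n => P0)
        {x | ∏ i, (f (x i) : ℝ≥0∞) < ENNReal.ofReal (Real.exp (-(2 * (n * e))))}
      ≤ ENNReal.ofReal (1 / (n * e)) := by
  have hn0 : (0 : ℝ) < n := by exact_mod_cast hn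
  set l : 𝒳 → ℝ := fun x => Real.log (f x)
  have hl : Measurable l := hf.coe_nnreal_real.log
  have hsqint : Integrable (fun x => l x ^ 2) P0 := by
    refine ⟨(hl.pow_const 2).aestronglyMeasurable, ?_⟩
    rw [hasFiniteIntegral_iff_ofReal (ae_of_all _ fun x => sq_nonneg _)]
    exact hsq.trans_lt ENNReal.ofReal_lt_top
  have hL2 : MemLp l 2 P0 := (memLp_two_iff_integrable_sq hl.aestronglyMeasurable).2 hsqint
  have hint : Integrable l P0 := hL2.integrable one_le_two
  have hvar1 : ProbabilityTheory.variance l P0 ≤ e := by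
    refine (ProbabilityTheory.variance_le_expectation_sq hl.aestronglyMeasurable).trans ?_
    change ∫ x, l x ^ 2 ∂P0 ≤ e
    rw [integral_eq_lintegral_of_nonneg_ae (ae_of_all _ fun x => sq_nonneg _)
      (hl.pow_const 2).aestronglyMeasurable]
    exact ENNReal.toReal_le_of_le_ofReal he.le hsq
  set S : (Fin n → 𝒳) → ℝ := ∑ i, fun x => l (x i)
  have hcomp : ∀ i : Fin n, MemLp (fun x : Fin n → 𝒳 => l (x i)) 2 (Measure.pi fun _ => P0) :=
    fun i => hL2.comp_measurePreserving (measurePreserving_eval (fun _ : Fin n => P0) i)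
  have hS : MemLp S 2 (Measure.pi fun _ => P0) := memLp_finsetSum' _ fun i _ => hcomp i
  have hSmean : ∫ x, S x ∂(Measure.pi fun _ => P0) = n * ∫ x, l x ∂P0 := by
    simp only [S, Finset.sum_apply]
    rw [integral_finsetSum _ fun i _ => (hcomp i).integrable one_le_two]
    have : ∀ i : Fin n, ∫ x, l (x i) ∂(Measure.pi fun _ : Fin n => P0) = ∫ x, l x ∂P0 := by
      intro i
      have hmp := measurePreserving_eval (fun _ : Fin n => P0) i
      conv_rhs => rw [← hmp.map_eq]
      rw [integral_map (measurable_pi_apply i).aemeasurable hl.aestronglyMeasurable]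
    simp [this]
  have hSvar : ProbabilityTheory.variance S (Measure.pi fun _ => P0) ≤ n * e := by
    rw [ProbabilityTheory.variance_sum_pi fun _ => hL2]
    simpa using mul_le_mul_of_nonneg_left hvar1 hn0.le
  have hposn : ∀ᵐ x ∂(Measure.pi fun _ : Fin n => P0), ∀ i, 0 < f (x i) :=
    ae_all_iff.2 fun i =>
      (measurePreserving_eval (fun _ : Fin n => P0) i).quasiMeasurePreserving.ae hpos
  calc _ ≤ Measure.pi (fun _ : Fin n => P0)
        {x | n * e ≤ |S x - ∫ x, S x ∂(Measure.pi fun _ => P0)|} := by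
        refine measure_mono_ae ?_
        filter_upwards [hposn] with x hx hlt
        change ∏ i, (f (x i) : ℝ≥0∞) < ENNReal.ofReal _ at hlt
        change n * e ≤ |S x - _|
        have hprod : (∏ i, (f (x i) : ℝ)) < Real.exp (-(2 * (n * e))) := by
          rw [← ENNReal.ofNNReal_finsetProd, ← ENNReal.ofReal_coe_nnreal,
            ENNReal.ofReal_lt_ofReal_iff (Real.exp_pos _)] at hlt
          simpa using hlt
        have hSx : S x = Real.log (∏ i, (f (x i) : ℝ)) := by
          rw [Real.log_prod fun i _ => by exact_mod_cast (hx i).ne']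
          simp [S, l]
        have hlog : S x < -(2 * (n * e)) := by
          rw [hSx, Real.log_lt_iff_lt_exp
            (Finset.prod_pos fun i _ => by exact_mod_cast hx i)]
          exact hprod
        have : -(n * e) ≤ n * ∫ x, l x ∂P0 := by nlinarith
        rw [hSmean, abs_sub_comm]
        refine le_trans ?_ (le_abs_self _)
        linarith
    _ ≤ ENNReal.ofReal (ProbabilityTheory.variance S (Measure.pi fun _ => P0) / (n * e) ^ 2) :=
        ProbabilityTheory.meas_ge_le_variance_div_sq hS (by positivity)
    _ ≤ ENNReal.ofReal (1 / (n * e)) := by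
        apply ENNReal.ofReal_le_ofReal
        rw [div_le_div_iff₀ (by positivity) (by positivity)]
        nlinarith [mul_pos hn0 he]

/-- Lower bound for the evidence: if every likelihood ratio `f θ` falls below `c` with probability
at most `δ`, then the integrated one falls below half of `c` times the prior mass with probability
at most `2 δ`, by Fubini's theorem and Markov's inequality for the mass of the `θ` below `c`. -/
lemma measure_lintegral_lt_le {Ω : Type*} [MeasurableSpace Ω] {ρ : Measure Ω} [SFinite ρ]
    (τ : Measure Θ) [IsFiniteMeasure τ] (hτ : τ Set.univ ≠ 0) {f : Θ → Ω → ℝ≥0∞}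
    (hf : Measurable fun z : Θ × Ω => f z.1 z.2) {c δ : ℝ≥0∞} (hc : c ≠ 0) (hc' : c ≠ ⊤)
    (hδ : ∀ θ, ρ {x | f θ x < c} ≤ δ) :
    ρ {x | ∫⁻ θ, f θ x ∂τ < c * (τ Set.univ / 2)} ≤ 2 * δ := by
  have hτ2 : τ Set.univ / 2 ≠ 0 := by simp [hτ]
  have hτ2' : τ Set.univ / 2 ≠ ⊤ := (ENNReal.div_lt_top (measure_ne_top _ _) two_ne_zero).ne
  have hG : MeasurableSet {z : Θ × Ω | f z.1 z.2 < c} := measurableSet_lt hf measurable_const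
  have hx : ∀ x, Measurable fun θ => f θ x := fun x =>
    hf.comp (measurable_id.prodMk measurable_const)
  calc ρ {x | ∫⁻ θ, f θ x ∂τ < c * (τ Set.univ / 2)}
      ≤ ρ {x | τ Set.univ / 2 ≤ τ {θ | f θ x < c}} := by
        refine measure_mono fun x hlt => ?_
        change ∫⁻ θ, f θ x ∂τ < c * (τ Set.univ / 2) at hlt
        change τ Set.univ / 2 ≤ τ {θ | f θ x < c}
        have h1 : τ {θ | c ≤ f θ x} < τ Set.univ / 2 :=
          (ENNReal.mul_lt_mul_iff_right hc hc').1
            ((mul_meas_ge_le_lintegral (hx x) c).trans_lt hlt)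
        have h2 : τ Set.univ ≤ τ {θ | f θ x < c} + τ {θ | c ≤ f θ x} := by
          refine (measure_mono fun θ _ => ?_).trans (measure_union_le _ _)
          exact lt_or_ge (f θ x) c
        by_contra! hcon
        have := h2.trans_lt (ENNReal.add_lt_add hcon h1)
        rw [ENNReal.add_halves] at this
        exact lt_irrefl _ this
    _ ≤ (∫⁻ x, τ {θ | f θ x < c} ∂ρ) / (τ Set.univ / 2) :=
        meas_ge_le_lintegral_div (measurable_measure_prodMk_right hG).aemeasurable hτ2 hτ2'
    _ = (∫⁻ θ, ρ {x | f θ x < c} ∂τ) / (τ Set.univ / 2) := by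
        congr 1
        exact (Measure.prod_apply_symm hG).symm.trans (Measure.prod_apply hG)
    _ ≤ (δ * τ Set.univ) / (τ Set.univ / 2) := by
        gcongr
        calc _ ≤ ∫⁻ _, δ ∂τ := lintegral_mono hδ
          _ = _ := by simp
    _ = 2 * δ := by
        have h : δ * τ Set.univ = 2 * δ * (τ Set.univ / 2) := by
          rw [mul_comm 2 δ, mul_assoc, ENNReal.mul_div_cancel two_ne_zero ENNReal.ofNat_ne_top]
        rw [h, ENNReal.mul_div_cancel_right hτ2 hτ2']

/-! ### Likelihood masses of separated convex sets -/

lemma average_mem_of_convex {E : Type*} [AddCommMonoid E] [Module ℝ≥0 E] {U : Set E}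
    (hU : Convex ℝ≥0 U) {z : ℕ → E} (hz : ∀ i, z i ∈ U) (n : ℕ) :
    ((n + 1 : ℕ) : ℝ≥0)⁻¹ • ∑ i ∈ Finset.range (n + 1), z i ∈ U := by
  induction n with
  | zero => simpa using hz 0
  | succ n ih =>
    have h := hU ih (hz (n + 1)) (a := ((n + 1 : ℕ) : ℝ≥0) / ((n + 2 : ℕ) : ℝ≥0))
      (b := ((n + 2 : ℕ) : ℝ≥0)⁻¹) zero_le zero_le (by
        field_simp; push_cast; ring)
    convert! h using 1
    rw [Finset.sum_range_succ _ (n + 1), smul_add, smul_smul]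
    congr 2
    field_simp

/-- The affinity bound on a convex set of likelihood ratios passes to integral mixtures with
respect to finite measures, by homogeneity of the power. -/
lemma affinity_lintegral_le_mul {P0 : Measure 𝒳} [SFinite P0] {U : Set (𝒳 → ℝ≥0)}
    (hU : Convex ℝ≥0 U) {α : ℝ} (hα : 0 ≤ α) {t : ℝ≥0∞}
    (ht : ∀ u ∈ U, affinity P0 (fun x => u x) α ≤ t)
    {q : Θ → 𝒳 → ℝ≥0} (hq : Measurable fun z : Θ × 𝒳 => q z.1 z.2) (hqU : ∀ θ, q θ ∈ U)
    (τ : Measure Θ) [IsFiniteMeasure τ] (hfin : ∀ᵐ x ∂P0, ∫⁻ θ, q θ x ∂τ < ⊤) :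
    affinity P0 (fun x => ∫⁻ θ, q θ x ∂τ) α ≤ t * posRpow (τ Set.univ) α := by
  rcases eq_or_ne τ 0 with rfl | hτ
  · simp [affinity]
  have hne : τ Set.univ ≠ 0 := by simpa using hτ
  have : NeZero τ := ⟨hτ⟩
  set τ' : Measure Θ := (τ Set.univ)⁻¹ • τ
  have hscale : ∀ x, ∫⁻ θ, (q θ x : ℝ≥0∞) ∂τ = τ Set.univ * ∫⁻ θ, q θ x ∂τ' := fun x => by
    rw [lintegral_smul_measure, smul_eq_mul, ← mul_assoc,
      ENNReal.mul_inv_cancel hne (measure_ne_top _ _), one_mul]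
  have hfin' : ∀ᵐ x ∂P0, ∫⁻ θ, q θ x ∂τ' < ⊤ := by
    filter_upwards [hfin] with x hx
    rw [lintegral_smul_measure, smul_eq_mul]
    exact ENNReal.mul_lt_top (ENNReal.inv_lt_top.2 (pos_iff_ne_zero.2 hne)) hx
  have hmain : affinity P0 (fun x => ∫⁻ θ, q θ x ∂τ') α ≤ t :=
    affinity_lintegral_le τ' hq hfin' fun n ω => by
      have := ht _ (average_mem_of_convex hU (fun i => hqU (ω i)) n)
      simpa [Finset.sum_apply] using this
  calc affinity P0 (fun x => ∫⁻ θ, q θ x ∂τ) α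
      = posRpow (τ Set.univ) α * affinity P0 (fun x => ∫⁻ θ, q θ x ∂τ') α := by
        simp only [affinity, hscale, posRpow_mul hα]
        exact lintegral_const_mul _
          ((measurable_posRpow α).comp hq.coe_nnreal_ennreal.lintegral_prod_left')
    _ ≤ posRpow (τ Set.univ) α * t := by gcongr
    _ = t * posRpow (τ Set.univ) α := mul_comm _ _

/-- The likelihood ratios `f / p*` of the measures in `B` that have a finite `μ`-density `f`. -/
def likelihoodRatios (μ : Measure 𝒳) (pstar : 𝒳 → ℝ≥0) (B : Set (Measure 𝒳)) :
    Set (𝒳 → ℝ≥0) :=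
  {u | ∃ f : 𝒳 → ℝ≥0, Measurable f ∧ μ.withDensity (fun x => (f x : ℝ≥0∞)) ∈ B ∧
    u = fun x => f x / pstar x}

lemma convex_likelihoodRatios (μ : Measure 𝒳) (pstar : 𝒳 → ℝ≥0) {B : Set (Measure 𝒳)}
    (hB : Convex ℝ≥0 B) : Convex ℝ≥0 (likelihoodRatios μ pstar B) := by
  rintro _ ⟨f, hf, hfB, rfl⟩ _ ⟨g, hg, hgB, rfl⟩ a b ha hb hab
  refine ⟨fun x => a * f x + b * g x, by fun_prop, ?_, ?_⟩
  · have h : μ.withDensity (fun x => ((a * f x + b * g x : ℝ≥0) : ℝ≥0∞)) =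
        a • μ.withDensity (fun x => (f x : ℝ≥0∞)) + b • μ.withDensity fun x => (g x : ℝ≥0∞) := by
      have h1 := withDensity_smul (μ := μ) (a : ℝ≥0∞) hf.coe_nnreal_ennreal
      have h2 := withDensity_smul (μ := μ) (b : ℝ≥0∞) hg.coe_nnreal_ennreal
      rw [← ENNReal.smul_def, ← ENNReal.smul_def] at h1 h2
      rw [← h1, ← h2, ← withDensity_add_left (hf.coe_nnreal_ennreal.const_smul a)]
      congr 1
    rw [h]
    exact hB hfB hgB ha hb hab
  · ext x
    simp [add_div, mul_div_assoc]

lemma ae_pos_of_absolutelyContinuous {μ P0 : Measure 𝒳} {pstar : 𝒳 → ℝ≥0}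
    (hpstar : Measurable pstar) (hac : P0 ≪ μ.withDensity fun x => (pstar x : ℝ≥0∞)) :
    ∀ᵐ x ∂P0, 0 < pstar x := by
  have h : ∀ᵐ x ∂μ.withDensity fun x => (pstar x : ℝ≥0∞), 0 < pstar x := by
    rw [ae_withDensity_iff hpstar.coe_nnreal_ennreal]
    exact ae_of_all _ fun x hx => pos_iff_ne_zero.2 (by simpa using hx)
  exact hac.ae_le h

/-- In a convex set of measures with testing separation at least `c > 0`, one exponent gives
affinities at most `exp (-c / 2)` for all of them. The loss from `c` to `c / 2` replaces the
supremum over the exponent by an attained value. -/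
lemma exists_exponent_of_testingSeparation {μ P0 : Measure 𝒳} [SigmaFinite μ] {pstar : 𝒳 → ℝ≥0}
    (hpstar : Measurable pstar) (hac : P0 ≪ μ.withDensity fun x => (pstar x : ℝ≥0∞))
    {B : Set (Measure 𝒳)} (hB : Convex ℝ≥0 B) {c : ℝ} (hc : 0 < c)
    (hsep : (c : EReal) ≤
      testingSeparation μ P0 (μ.withDensity fun x => (pstar x : ℝ≥0∞)) B) :
    ∃ α ∈ Set.Icc (0 : ℝ) 1, ∀ u ∈ likelihoodRatios μ pstar B,
      affinity P0 (fun x => u x) α ≤ ENNReal.ofReal (Real.exp (-(c / 2))) := by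
  refine exists_common_exponent (convex_likelihoodRatios μ pstar hB) ?_ ?_
  · rintro _ ⟨f, hf, -, rfl⟩
    exact hf.div hpstar
  rintro _ ⟨f, hf, hfB, rfl⟩
  have hμ : P0 ≪ μ := hac.trans (withDensity_absolutelyContinuous _ _)
  have h1 : ((c / 2 : ℝ) : EReal) < ⨆ α ∈ Set.Ioo (0 : ℝ) 1, -ENNReal.log (hellingerTransform μ P0
      (μ.withDensity fun x => (pstar x : ℝ≥0∞)) (μ.withDensity fun x => (f x : ℝ≥0∞)) α) :=
    (EReal.coe_lt_coe_iff.2 (half_lt_self hc)).trans_le (hsep.trans (iInf₂_le _ hfB))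
  simp only [lt_iSup_iff] at h1
  obtain ⟨α, hα, hlt⟩ := h1
  refine ⟨α, ⟨hα.1.le, hα.2.le⟩, le_of_eq_of_le ?_ (b := hellingerTransform μ P0
      (μ.withDensity fun x => (pstar x : ℝ≥0∞)) (μ.withDensity fun x => (f x : ℝ≥0∞)) α) ?_⟩
  · refine lintegral_congr_ae ?_
    filter_upwards [hμ.ae_le (Measure.rnDeriv_withDensity μ hf.coe_nnreal_ennreal),
      hμ.ae_le (Measure.rnDeriv_withDensity μ hpstar.coe_nnreal_ennreal),
      ae_pos_of_absolutelyContinuous hpstar hac] with x h1 h2 h3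
    rw [h1, h2, posRpow_of_pos hα.1, ENNReal.coe_div h3.ne']
  · rw [← ENNReal.log_le_log_iff, ENNReal.log_ofReal_of_pos (Real.exp_pos _), Real.log_exp]
    rw [EReal.coe_neg]
    exact EReal.le_neg_of_le_neg hlt.le

/-- The expected likelihood mass, truncated at `1`, of a set of parameters that a separated convex
set of measures contains. No measurability of `A` is needed. -/
lemma lintegral_min_one_le {μ P0 : Measure 𝒳} [SigmaFinite μ] [IsProbabilityMeasure P0]
    {pstar : 𝒳 → ℝ≥0} (hpstar : Measurable pstar)
    (hac : P0 ≪ μ.withDensity fun x => (pstar x : ℝ≥0∞))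
    {p : Θ → 𝒳 → ℝ≥0} (hp : Measurable fun z : Θ × 𝒳 => p z.1 z.2)
    (hprob : ∀ θ, IsProbabilityMeasure (μ.withDensity fun x => (p θ x : ℝ≥0∞)))
    {B : Set (Measure 𝒳)} (hB : Convex ℝ≥0 B) {c : ℝ} (hc : 0 < c)
    (hsep : (c : EReal) ≤ testingSeparation μ P0 (μ.withDensity fun x => (pstar x : ℝ≥0∞)) B)
    (ν : Measure Θ) [IsProbabilityMeasure ν] {A : Set Θ}
    (hA : ∀ θ ∈ A, μ.withDensity (fun x => (p θ x : ℝ≥0∞)) ∈ B) (n : ℕ) :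
    ∫⁻ x : Fin n → 𝒳, min 1 (∫⁻ θ in A, ∏ i, ((p θ (x i) / pstar (x i) : ℝ≥0) : ℝ≥0∞) ∂ν)
      ∂(Measure.pi fun _ => P0) ≤ ENNReal.ofReal (Real.exp (-(c / 2))) ^ n := by
  obtain ⟨α, ⟨h0, h1⟩, hα⟩ := exists_exponent_of_testingSeparation hpstar hac hB hc hsep
  have hq : Measurable fun z : Θ × 𝒳 => p z.1 z.2 / pstar z.2 :=
    hp.div (hpstar.comp measurable_snd)
  obtain ⟨τ, hτ⟩ := exists_measure_subtype_map_eq_restrict ν A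
  have hτ1 : τ Set.univ ≤ 1 := by
    have := congrArg (fun m => m Set.univ) hτ
    simp only [Measure.map_apply measurable_subtype_coe MeasurableSet.univ, Set.preimage_univ,
      Measure.restrict_apply_univ] at this
    exact this.le.trans prob_le_one
  have : IsFiniteMeasure τ := ⟨hτ1.trans_lt ENNReal.one_lt_top⟩
  set q : A → 𝒳 → ℝ≥0 := fun θ x => p θ x / pstar x
  have hqA : Measurable fun z : A × 𝒳 => q z.1 z.2 :=
    hq.comp ((measurable_subtype_coe.comp measurable_fst).prodMk measurable_snd)
  have hpA : Measurable fun z : A × 𝒳 => p z.1 z.2 :=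
    hp.comp ((measurable_subtype_coe.comp measurable_fst).prodMk measurable_snd)
  have hqU : ∀ θ, q θ ∈ likelihoodRatios μ pstar B := fun θ =>
    ⟨p θ, hp.comp (measurable_const.prodMk measurable_id), hA θ θ.2, rfl⟩
  have hfin : ∀ (σ : Measure A) [IsFiniteMeasure σ], ∀ᵐ x ∂P0, ∫⁻ θ, q θ x ∂σ < ⊤ := by
    intro σ _
    -- A finite mixture of densities has a finite `μ`-integral.
    have hμ : ∀ᵐ x ∂μ, ∫⁻ θ, (p θ x : ℝ≥0∞) ∂σ < ⊤ := by
      refine ae_lt_top hpA.coe_nnreal_ennreal.lintegral_prod_left' ?_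
      rw [lintegral_lintegral_swap
        (hpA.comp measurable_swap).coe_nnreal_ennreal.aemeasurable]
      have : ∀ θ : A, ∫⁻ x, (p θ x : ℝ≥0∞) ∂μ = 1 := fun θ => by
        have := (hprob θ).measure_univ
        rwa [withDensity_apply _ MeasurableSet.univ, Measure.restrict_univ] at this
      simp [this]
    filter_upwards [(hac.trans (withDensity_absolutelyContinuous _ _)).ae_le hμ,
      ae_pos_of_absolutelyContinuous hpstar hac] with x hx hx0
    have hxm : Measurable fun θ : A => (p θ x : ℝ≥0∞) :=
      (hpA.comp (measurable_id.prodMk measurable_const)).coe_nnreal_ennreal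
    have : ∫⁻ θ, (q θ x : ℝ≥0∞) ∂σ = (∫⁻ θ, (p θ x : ℝ≥0∞) ∂σ) * (pstar x : ℝ≥0∞)⁻¹ := by
      rw [← lintegral_mul_const _ hxm]
      exact lintegral_congr fun θ => by
        simp only [q]
        rw [ENNReal.coe_div hx0.ne', div_eq_mul_inv]
    rw [this]
    exact ENNReal.mul_lt_top hx (ENNReal.inv_lt_top.2 (by exact_mod_cast hx0))
  calc _ ≤ ∫⁻ x : Fin n → 𝒳, posRpow (∫⁻ θ, ∏ i, (q θ (x i) : ℝ≥0∞) ∂τ) α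
          ∂(Measure.pi fun _ => P0) := by
        refine lintegral_mono fun x => (min_one_le_posRpow h0 h1 _).trans_eq ?_
        have hx : Measurable fun θ => ∏ i, ((p θ (x i) / pstar (x i) : ℝ≥0) : ℝ≥0∞) :=
          (measurable_prod_coe (q := fun θ x => p θ x / pstar x) hq).comp
            (measurable_id.prodMk measurable_const)
        rw [← hτ, lintegral_map hx measurable_subtype_coe]
    _ ≤ _ := lintegral_posRpow_lintegral_prod_le hqA hfin
        (fun σ _ => affinity_lintegral_le_mul (convex_likelihoodRatios μ pstar hB) h0 hα hqA hqU σ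
          (hfin σ)) n τ
    _ ≤ _ := mul_le_of_le_one_right' (posRpow_le_one h0 hτ1)

/-! ### From likelihood masses to the posterior -/

lemma posteriorMass_le_one {𝒴 : Type*} (ν : Measure Θ) (p : Θ → 𝒴 → ℝ≥0) {n : ℕ} (x : Fin n → 𝒴)
    (A : Set Θ) : posteriorMass ν p x A ≤ 1 :=
  ENNReal.div_le_of_le_mul (by rw [one_mul]; exact setLIntegral_le_lintegral _ _)

/-- Dividing all densities by `p*` does not change the posterior. -/
lemma posteriorMass_div {𝒴 : Type*} (ν : Measure Θ) {p : Θ → 𝒴 → ℝ≥0} {pstar : 𝒴 → ℝ≥0} {n : ℕ}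
    {x : Fin n → 𝒴} (hx : ∀ i, 0 < pstar (x i)) (A : Set Θ) :
    posteriorMass ν p x A = posteriorMass ν (fun θ y => p θ y / pstar y) x A := by
  set c : ℝ≥0∞ := ((∏ i, pstar (x i) : ℝ≥0) : ℝ≥0∞)
  have hc : c ≠ 0 := by
    simpa [c, Finset.prod_eq_zero_iff] using fun i => (hx i).ne'
  have hc' : c ≠ ⊤ := ENNReal.coe_ne_top
  have hprod : ∀ θ, ∏ i, (p θ (x i) : ℝ≥0∞) =
      c * ∏ i, ((p θ (x i) / pstar (x i) : ℝ≥0) : ℝ≥0∞) := by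
    intro θ
    rw [← ENNReal.ofNNReal_finsetProd, ← ENNReal.ofNNReal_finsetProd, ← ENNReal.coe_mul,
      ← Finset.prod_mul_distrib]
    congr 2
    ext i
    rw [mul_div_cancel₀ _ (hx i).ne']
  simp only [posteriorMass, hprod]
  rw [lintegral_const_mul' _ _ hc', lintegral_const_mul' _ _ hc',
    ENNReal.mul_div_mul_left _ _ hc hc']

lemma min_one_tsum_div_le {ι : Type*} (a : ι → ℝ≥0∞) {d : ℝ≥0∞} (hd : d ≤ 1) :
    min 1 ((∑' k, a k) / d) ≤ d⁻¹ * ∑' k, min 1 (a k) := by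
  by_cases h : ∃ k, 1 ≤ a k
  · obtain ⟨k, hk⟩ := h
    calc min 1 ((∑' k, a k) / d) ≤ 1 * 1 := by rw [one_mul]; exact min_le_left _ _
      _ ≤ d⁻¹ * ∑' k, min 1 (a k) := by
        gcongr
        · exact ENNReal.one_le_inv.2 hd
        · exact le_trans (by rw [min_eq_left hk]) (ENNReal.le_tsum k)
  · push Not at h
    refine (min_le_right _ _).trans ?_
    rw [div_eq_mul_inv, mul_comm]
    gcongr with k
    rw [min_eq_right (h k).le]

/-- The expected posterior mass of a set is at most the probability that the evidence falls below
`d`, plus `d⁻¹` times the truncated likelihood masses of the pieces of a countable cover. -/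
lemma lintegral_posteriorMass_le {P0 : Measure 𝒳} [IsProbabilityMeasure P0] (ν : Measure Θ)
    [IsProbabilityMeasure ν] {p : Θ → 𝒳 → ℝ≥0} (hp : Measurable fun z : Θ × 𝒳 => p z.1 z.2)
    {pstar : 𝒳 → ℝ≥0} (hpstar : Measurable pstar) (hpos : ∀ᵐ x ∂P0, 0 < pstar x)
    {ι : Type*} [Countable ι] {A : Set Θ} {As : ι → Set Θ} (hA : A ⊆ ⋃ k, As k) {n : ℕ}
    {d : ℝ≥0∞} (hd : d ≤ 1) :
    ∫⁻ x : Fin n → 𝒳, posteriorMass ν p x A ∂(Measure.pi fun _ => P0) ≤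
      Measure.pi (fun _ : Fin n => P0)
        {x | ∫⁻ θ, ∏ i, ((p θ (x i) / pstar (x i) : ℝ≥0) : ℝ≥0∞) ∂ν < d} +
      d⁻¹ * ∑' k, ∫⁻ x : Fin n → 𝒳,
        min 1 (∫⁻ θ in As k, ∏ i, ((p θ (x i) / pstar (x i) : ℝ≥0) : ℝ≥0∞) ∂ν)
          ∂(Measure.pi fun _ => P0) := by
  set q : Θ → 𝒳 → ℝ≥0 := fun θ y => p θ y / pstar y
  have hq : Measurable fun z : Θ × 𝒳 => q z.1 z.2 := hp.div (hpstar.comp measurable_snd)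
  have hbad : MeasurableSet {x : Fin n → 𝒳 | ∫⁻ θ, ∏ i, (q θ (x i) : ℝ≥0∞) ∂ν < d} :=
    measurableSet_lt (measurable_lintegral_prod ν hq) measurable_const
  have hmin : ∀ k, Measurable fun x : Fin n → 𝒳 =>
      min 1 (∫⁻ θ in As k, ∏ i, (q θ (x i) : ℝ≥0∞) ∂ν) := fun k =>
    measurable_const.min (measurable_lintegral_prod _ hq)
  have hposn : ∀ᵐ x ∂(Measure.pi fun _ : Fin n => P0), ∀ i, 0 < pstar (x i) :=
    ae_all_iff.2 fun i =>
      (measurePreserving_eval (fun _ : Fin n => P0) i).quasiMeasurePreserving.ae hpos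
  calc ∫⁻ x : Fin n → 𝒳, posteriorMass ν p x A ∂(Measure.pi fun _ => P0)
      ≤ ∫⁻ x : Fin n → 𝒳,
          ({x : Fin n → 𝒳 | ∫⁻ θ, ∏ i, (q θ (x i) : ℝ≥0∞) ∂ν < d}.indicator 1 x +
            d⁻¹ * ∑' k, min 1 (∫⁻ θ in As k, ∏ i, (q θ (x i) : ℝ≥0∞) ∂ν))
          ∂(Measure.pi fun _ => P0) := by
        refine lintegral_mono_ae (hposn.mono fun x hx => ?_)
        rw [posteriorMass_div ν hx]
        rcases lt_or_ge (∫⁻ θ, ∏ i, (q θ (x i) : ℝ≥0∞) ∂ν) d with hlt | hge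
        · refine (posteriorMass_le_one _ _ _ _).trans (le_add_right ?_)
          rw [Set.indicator_of_mem (by exact hlt)]
          rfl
        · refine le_add_left (le_trans (le_min (posteriorMass_le_one _ _ _ _) ?_)
            (min_one_tsum_div_le _ hd))
          refine ENNReal.div_le_div ?_ hge
          exact (lintegral_mono_set hA).trans (lintegral_iUnion_le _ _)
    _ = _ := by
        rw [lintegral_add_left (measurable_one.indicator hbad), lintegral_indicator_one hbad,
          lintegral_const_mul _ (Measurable.tsum hmin),
          lintegral_tsum fun k => (hmin k).aemeasurable]

/-- With high probability the evidence is at least the prior mass of the Kullback–Leibler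
neighbourhood, up to an exponential factor. -/
lemma measure_evidence_lt_le {P0 : Measure 𝒳} [IsProbabilityMeasure P0] (ν : Measure Θ)
    [IsProbabilityMeasure ν] {p : Θ → 𝒳 → ℝ≥0} (hp : Measurable fun z : Θ × 𝒳 => p z.1 z.2)
    {θstar : Θ} (hpos : ∀ᵐ x ∂P0, 0 < p θstar x) {ε : ℝ} (hε : 0 < ε) {b : ℝ≥0∞} (hb : b ≠ 0)
    (hν : b ≤ ν (klNeighborhood P0 p θstar ε)) {n : ℕ} (hn : 1 ≤ n) :
    Measure.pi (fun _ : Fin n => P0)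
        {x | ∫⁻ θ, ∏ i, ((p θ (x i) / p θstar (x i) : ℝ≥0) : ℝ≥0∞) ∂ν <
          ENNReal.ofReal (Real.exp (-(2 * (n * ε ^ 2)))) * (b / 2)} ≤
      2 * ENNReal.ofReal (1 / (n * ε ^ 2)) := by
  set K := klNeighborhood P0 p θstar ε
  have hpstar : Measurable (p θstar) := hp.comp (measurable_const.prodMk measurable_id)
  obtain ⟨τ, hτ⟩ := exists_measure_subtype_map_eq_restrict ν K
  have hτK : τ Set.univ = ν K := by
    have := congrArg (fun m => m Set.univ) hτ
    simpa only [Measure.map_apply measurable_subtype_coe MeasurableSet.univ, Set.preimage_univ,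
      Measure.restrict_apply_univ] using this
  have : IsFiniteMeasure τ := ⟨by rw [hτK]; exact measure_lt_top _ _⟩
  have hq : Measurable fun z : Θ × 𝒳 => p z.1 z.2 / p θstar z.2 :=
    hp.div (hpstar.comp measurable_snd)
  have hprod : Measurable fun z : Θ × (Fin n → 𝒳) =>
      ∏ i, ((p z.1 (z.2 i) / p θstar (z.2 i) : ℝ≥0) : ℝ≥0∞) :=
    measurable_prod_coe (q := fun θ y => p θ y / p θstar y) hq
  have hf : Measurable fun z : K × (Fin n → 𝒳) =>
      ∏ i, ((p z.1 (z.2 i) / p θstar (z.2 i) : ℝ≥0) : ℝ≥0∞) :=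
    hprod.comp ((measurable_subtype_coe.comp measurable_fst).prodMk measurable_snd)
  refine le_trans (measure_mono fun x hx => ?_) (measure_lintegral_lt_le τ
    (f := fun (θ : K) (x : Fin n → 𝒳) => ∏ i, ((p θ (x i) / p θstar (x i) : ℝ≥0) : ℝ≥0∞))
    (c := ENNReal.ofReal (Real.exp (-(2 * (n * ε ^ 2)))))
    (δ := ENNReal.ofReal (1 / (n * ε ^ 2))) ?_ hf ?_ ENNReal.ofReal_ne_top ?_)
  · rw [Set.mem_ofPred_eq] at hx ⊢
    refine lt_of_le_of_lt ?_ (lt_of_lt_of_le hx ?_)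
    · have hx : Measurable fun θ => ∏ i, ((p θ (x i) / p θstar (x i) : ℝ≥0) : ℝ≥0∞) :=
        hprod.comp (measurable_id.prodMk measurable_const)
      calc _ = ∫⁻ θ in K, ∏ i, ((p θ (x i) / p θstar (x i) : ℝ≥0) : ℝ≥0∞) ∂ν := by
            rw [← hτ, lintegral_map hx measurable_subtype_coe]
        _ ≤ _ := setLIntegral_le_lintegral _ _
    · rw [hτK]; gcongr
  · rw [hτK]; exact ((pos_iff_ne_zero.2 hb).trans_le hν).ne'
  · simpa using Real.exp_pos _
  · rintro ⟨θ, hθ⟩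
    obtain ⟨h1, h2, h3⟩ := hθ
    refine measure_pi_prod_lt_le (f := fun y => p θ y / p θstar y)
      (hq.comp (measurable_const.prodMk measurable_id)) ?_ (by positivity) ?_ ?_ hn
    · filter_upwards [h1, hpos] with x hx hx'
      exact div_pos hx hx'
    · simpa only [NNReal.coe_div] using h2
    · simpa only [NNReal.coe_div] using h3

lemma exists_testingCover {μ P0 : Measure 𝒳} {𝓜 : Set (Measure 𝒳)} [PseudoMetricSpace 𝓜]
    {Pstar : 𝓜} {ε : ℝ} {b : ℝ≥0∞} (hb : b < ⊤)
    (h : (testingCoveringNumber μ P0 Pstar ε : ℝ≥0∞) ≤ b) :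
    ∃ (N : ℕ) (B : Fin N → Set (Measure 𝒳)), IsTestingCover μ P0 Pstar ε B ∧ (N : ℝ≥0∞) ≤ b := by
  have htop : testingCoveringNumber μ P0 Pstar ε ≠ ⊤ := by
    intro h'
    rw [h', ENat.toENNReal_top] at h
    exact (h.trans_lt hb).ne rfl
  have hlt : testingCoveringNumber μ P0 Pstar ε < testingCoveringNumber μ P0 Pstar ε + 1 :=
    (ENat.lt_add_one_iff htop).2 le_rfl
  conv_lhs at hlt => unfold testingCoveringNumber
  simp only [iInf_lt_iff] at hlt
  obtain ⟨N, ⟨B, hB⟩, hN⟩ := hlt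
  refine ⟨N, B, hB, le_trans ?_ h⟩
  have := ENat.toENNReal_le.2 ((ENat.lt_add_one_iff htop).1 hN)
  simpa using this

/-- Geometrically growing radii give shells `(δ, 2 δ)` that cover the complement of a ball; the
growth rate `3 / 2 < 2` makes the open shells overlap. -/
lemma exists_shell {r x : ℝ} (hr : 0 < r) (hx : r ≤ x) :
    ∃ j : ℕ, 3 / 4 * r * (3 / 2) ^ j < x ∧ x < 2 * (3 / 4 * r * (3 / 2) ^ j) := by
  obtain ⟨j, h1, h2⟩ := exists_nat_pow_near ((one_le_div hr).2 hx) (by norm_num : (1 : ℝ) < 3 / 2)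
  rw [le_div_iff₀ hr] at h1
  rw [div_lt_iff₀ hr, pow_succ] at h2
  have : 0 < (3 / 2 : ℝ) ^ j * r := by positivity
  exact ⟨j, by linarith, by linarith⟩

/-- Summing the bounds over the shells: for `w ≥ 1` the total is dominated by the first shell. -/
lemma tsum_shell_le {L M w : ℝ} (hL : 0 < L) (hM : 15 * (L + 4) ≤ M) (hw : 1 ≤ w) :
    (ENNReal.ofReal (Real.exp (-(2 * w))) * (ENNReal.ofReal (Real.exp (-(L * w))) / 2))⁻¹ *
      ∑' j : ℕ, ENNReal.ofReal (Real.exp w) *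
        ENNReal.ofReal (Real.exp (-(w * (3 / 4 * M * (3 / 2) ^ j) ^ 2 / 8)))
      ≤ ENNReal.ofReal (4 * Real.exp (-w)) := by
  set r : ℝ := Real.exp (-((L + 4) * w))
  have hr0 : 0 < r := Real.exp_pos _
  have hr1 : r ≤ 1 / 2 := by
    have h1 : (2 : ℝ) ≤ Real.exp ((L + 4) * w) := by
      have := Real.add_one_le_exp ((L + 4) * w)
      nlinarith
    simp only [r]
    rw [Real.exp_neg, ← one_div]
    exact one_div_le_one_div_of_le (by norm_num) h1
  have hterm : ∀ j : ℕ, Real.exp (-(w * (3 / 4 * M * (3 / 2) ^ j) ^ 2 / 8)) ≤ r * (1 / 2) ^ j := by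
    intro j
    calc Real.exp (-(w * (3 / 4 * M * (3 / 2) ^ j) ^ 2 / 8)) ≤ r * r ^ j := by
          rw [← pow_succ', ← Real.exp_nat_mul, Real.exp_le_exp]
          -- Bernoulli's inequality makes the bounds geometric in `j`.
          have h1 : (1 : ℝ) + j * (5 / 4) ≤ (9 / 4) ^ j := by
            have := one_add_mul_le_pow (by norm_num : (-2 : ℝ) ≤ 5 / 4) j
            norm_num at this ⊢
            exact this
          have h2 : (3 / 4 * M * (3 / 2) ^ j) ^ 2 = 9 / 16 * M ^ 2 * (9 / 4 : ℝ) ^ j := by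
            rw [mul_pow, mul_pow, ← pow_mul, mul_comm j 2, pow_mul]; norm_num
          -- `M ≥ 15 (L + 4) ≥ 60` makes the constant of the first shell beat `L + 4`.
          have h3 : 8 * (L + 4) ≤ 9 / 16 * M ^ 2 := by nlinarith
          have h4 : 8 * (L + 4) * (j + 1) ≤ 9 / 16 * M ^ 2 * (9 / 4 : ℝ) ^ j :=
            mul_le_mul h3 (by have : (0 : ℝ) ≤ j := j.cast_nonneg
                              linarith) (by positivity) (by positivity)
          rw [h2]
          push_cast
          nlinarith
      _ ≤ r * (1 / 2) ^ j := by gcongr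
  have hsum : ∑' j : ℕ, ENNReal.ofReal (Real.exp w) *
      ENNReal.ofReal (Real.exp (-(w * (3 / 4 * M * (3 / 2) ^ j) ^ 2 / 8))) ≤
      ENNReal.ofReal (Real.exp w * (r * 2)) := by
    rw [ENNReal.tsum_mul_left, ENNReal.ofReal_mul (Real.exp_pos _).le]
    gcongr
    calc _ ≤ ∑' j : ℕ, ENNReal.ofReal (r * (1 / 2) ^ j) :=
          ENNReal.tsum_le_tsum fun j => ENNReal.ofReal_le_ofReal (hterm j)
      _ = ENNReal.ofReal (r * 2) := by
          rw [← ENNReal.ofReal_tsum_of_nonneg (fun j => by positivity)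
            (summable_geometric_two.mul_left r), tsum_mul_left, tsum_geometric_two]
  have hd : ENNReal.ofReal (Real.exp (-(2 * w))) * (ENNReal.ofReal (Real.exp (-(L * w))) / 2) =
      ENNReal.ofReal (Real.exp (-(2 * w)) * (Real.exp (-(L * w)) / 2)) := by
    rw [ENNReal.ofReal_mul (Real.exp_pos _).le, ENNReal.ofReal_div_of_pos (by norm_num),
      ENNReal.ofReal_ofNat]
  rw [hd, ← ENNReal.ofReal_inv_of_pos (by positivity)]
  refine (mul_le_mul_right hsum _).trans ?_
  rw [← ENNReal.ofReal_mul (by positivity)]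
  refine ENNReal.ofReal_le_ofReal (le_of_eq ?_)
  rw [mul_inv, inv_div, ← Real.exp_neg, neg_neg, div_eq_mul_inv, ← Real.exp_neg, neg_neg]
  have : Real.exp (-w) = Real.exp (2 * w) * Real.exp (L * w) * (Real.exp w * r) := by
    simp only [r, ← Real.exp_add]
    congr 1; ring
  rw [this]; ring

end

/-! ### Posterior contraction -/

/-- The finite-sample form of the contraction theorem: as soon as `n ε² ≥ 1`, the expected posterior
mass outside the ball of radius `M ε` is at most `2 / (n ε²) + 4 exp (-n ε²)`. -/
lemma lintegral_posteriorMass_compl_ball_le {𝒳 : Type*} [MeasurableSpace 𝒳]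
    (μ : Measure 𝒳) [SigmaFinite μ]
    (𝓜 : Set (Measure 𝒳)) (h𝓜 : ∀ P ∈ 𝓜, IsProbabilityMeasure P)
    (m𝓜 : MeasurableSpace 𝓜)
    (p : 𝓜 → 𝒳 → ℝ≥0) (hp_meas : Measurable fun z : 𝓜 × 𝒳 => p z.1 z.2)
    (hp : ∀ P : 𝓜, (P : Measure 𝒳) = μ.withDensity fun x => (p P x : ℝ≥0∞))
    [PseudoMetricSpace 𝓜]
    (prior : Measure 𝓜) [IsProbabilityMeasure prior]
    (P0 : Measure 𝒳) [IsProbabilityMeasure P0]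
    (Pstar : 𝓜) (hac : P0 ≪ (Pstar : Measure 𝒳))
    {n : ℕ} (hn : 1 ≤ n) {ε : ℝ} (hε : 0 < ε) {L : ℝ} (hL : 0 < L)
    (hprior : ENNReal.ofReal (Real.exp (-(L * n * ε ^ 2))) ≤
      prior (klNeighborhood P0 p Pstar ε))
    (hentropy : ∀ δ : ℝ, ε < δ →
      (testingCoveringNumber μ P0 Pstar δ : ℝ≥0∞) ≤ ENNReal.ofReal (Real.exp (n * ε ^ 2)))
    {M : ℝ} (hM : 15 * (L + 4) ≤ M) (hw : 1 ≤ n * ε ^ 2) :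
    ∫⁻ x : Fin n → 𝒳, posteriorMass prior p x {P : 𝓜 | M * ε ≤ dist P Pstar}
        ∂(Measure.pi fun _ : Fin n => P0) ≤
      2 * ENNReal.ofReal (1 / (n * ε ^ 2)) + ENNReal.ofReal (4 * Real.exp (-(n * ε ^ 2))) := by
  set w : ℝ := n * ε ^ 2
  set δ : ℕ → ℝ := fun j => 3 / 4 * (M * ε) * (3 / 2) ^ j
  have hMε : 0 < M * ε := mul_pos (by linarith) hε
  have hδε : ∀ j, ε < δ j := by
    intro j
    have h1 : (1 : ℝ) ≤ (3 / 2) ^ j := one_le_pow₀ (by norm_num)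
    have h2 : ε < 3 / 4 * (M * ε) := by nlinarith
    calc ε < 3 / 4 * (M * ε) * 1 := by linarith
      _ ≤ δ j := by simp only [δ]; gcongr
  choose N B hB hN using fun j => exists_testingCover ENNReal.ofReal_lt_top
    (hentropy (δ j) (hδε j))
  have hpstar : Measurable (p Pstar) := hp_meas.comp (measurable_const.prodMk measurable_id)
  have hac' : P0 ≪ μ.withDensity fun x => (p Pstar x : ℝ≥0∞) := hp Pstar ▸ hac
  have hpos := ae_pos_of_absolutelyContinuous hpstar hac'
  set As : (Σ j, Fin (N j)) → Set 𝓜 := fun k => {P | (P : Measure 𝒳) ∈ B k.1 k.2}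
  have hcover : {P : 𝓜 | M * ε ≤ dist P Pstar} ⊆ ⋃ k, As k := by
    intro P hP
    obtain ⟨j, h1, h2⟩ := exists_shell hMε hP
    obtain ⟨i, hi⟩ := (hB j).covers P h1 h2
    exact Set.mem_iUnion.2 ⟨⟨j, i⟩, hi⟩
  have hpiece : ∀ k : Σ j, Fin (N j), ∫⁻ x : Fin n → 𝒳,
      min 1 (∫⁻ P in As k, ∏ i, ((p P (x i) / p Pstar (x i) : ℝ≥0) : ℝ≥0∞) ∂prior)
        ∂(Measure.pi fun _ => P0) ≤
      ENNReal.ofReal (Real.exp (-(w * (3 / 4 * M * (3 / 2) ^ k.1) ^ 2 / 8))) := by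
    rintro ⟨j, i⟩
    have hδ0 : 0 < δ j := hε.trans (hδε j)
    refine (lintegral_min_one_le hpstar hac' hp_meas (fun P => hp P ▸ h𝓜 P P.2)
      ((hB j).convex i) (c := δ j ^ 2 / 4) (by positivity) (hp Pstar ▸ (hB j).separated i) prior
      (fun P hP => hp P ▸ hP) n).trans (le_of_eq ?_)
    rw [← ENNReal.ofReal_pow (Real.exp_pos _).le, ← Real.exp_nat_mul]
    congr 2
    simp only [w, δ]
    ring
  set d : ℝ≥0∞ := ENNReal.ofReal (Real.exp (-(2 * w))) * (ENNReal.ofReal (Real.exp (-(L * w))) / 2)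
  have hexp : ∀ y : ℝ, 0 ≤ y → ENNReal.ofReal (Real.exp (-y)) ≤ 1 := fun y hy => by
    rw [ENNReal.ofReal_le_one, Real.exp_le_one_iff]; linarith
  have hd : d ≤ 1 := mul_le_one' (hexp _ (by positivity))
    (ENNReal.half_le_self.trans (hexp _ (by positivity)))
  refine (lintegral_posteriorMass_le prior hp_meas hpstar hpos hcover hd).trans (add_le_add ?_ ?_)
  · refine measure_evidence_lt_le prior hp_meas hpos hε ?_ ?_ hn
    · simpa using Real.exp_pos _
    · rwa [← mul_assoc]
  · refine le_trans ?_ (tsum_shell_le hL hM hw)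
    refine mul_le_mul_right ?_ _
    refine (ENNReal.tsum_le_tsum hpiece).trans ?_
    rw [ENNReal.tsum_sigma' fun k : Σ j, Fin (N j) =>
      ENNReal.ofReal (Real.exp (-(w * (3 / 4 * M * (3 / 2) ^ k.1) ^ 2 / 8)))]
    refine ENNReal.tsum_le_tsum fun j => ?_
    rw [tsum_fintype]
    simp only [Finset.sum_const, Finset.card_univ, Fintype.card_fin, nsmul_eq_mul]
    gcongr
    exact hN j

theorem theorem2p1 {𝒳 : Type*} [MeasurableSpace 𝒳]
    -- the model, dominated by a sigma-finite measure, with jointly measurable densities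
    (μ : Measure 𝒳) [SigmaFinite μ]
    (𝓜 : Set (Measure 𝒳)) (h𝓜 : ∀ P ∈ 𝓜, IsProbabilityMeasure P)
    (m𝓜 : MeasurableSpace 𝓜)
    (p : 𝓜 → 𝒳 → ℝ≥0) (hp_meas : Measurable fun z : 𝓜 × 𝒳 => p z.1 z.2)
    (hp : ∀ P : 𝓜, (P : Measure 𝒳) = μ.withDensity fun x => (p P x : ℝ≥0∞))
    -- the semi-metric, the prior, the true distribution and the point `P*`
    [PseudoMetricSpace 𝓜]
    (prior : Measure 𝓜) [IsProbabilityMeasure prior]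
    (P0 : Measure 𝒳) [IsProbabilityMeasure P0]
    (Pstar : 𝓜)
    (hKL : InformationTheory.klDiv P0 (Pstar : Measure 𝒳) < ⊤)
    (hratio : ∀ P : 𝓜, ∫⁻ x, (p P x : ℝ≥0∞) / (p Pstar x : ℝ≥0∞) ∂P0 < ⊤)
    (ε : ℕ → ℝ) (hε_pos : ∀ n, 1 ≤ n → 0 < ε n)
    (hε_zero : Tendsto ε atTop (𝓝 0))
    (hε_top : Tendsto (fun n : ℕ => (n : ℝ) * ε n ^ 2) atTop atTop)
    (L : ℝ) (hL : 0 < L)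
    (hprior : ∀ n : ℕ, 1 ≤ n →
      ENNReal.ofReal (Real.exp (-(L * n * ε n ^ 2))) ≤ prior (klNeighborhood P0 p Pstar (ε n)))
    (hentropy : ∀ n : ℕ, 1 ≤ n → ∀ δ : ℝ, ε n < δ →
      (testingCoveringNumber μ P0 Pstar δ : ℝ≥0∞) ≤ ENNReal.ofReal (Real.exp (n * ε n ^ 2))) :
    ∃ M₀ : ℝ, ∀ M : ℝ, M₀ ≤ M →
      Tendsto
        (fun n : ℕ =>
          ∫⁻ x : Fin n → 𝒳, posteriorMass prior p x {P : 𝓜 | M * ε n ≤ dist P Pstar}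
            ∂(Measure.pi fun _ : Fin n => P0))
        atTop (𝓝 0) := by
  -- A finite divergence forces `P₀ ≪ P*`, so that `p* > 0` holds `P₀`-almost surely.
  have hac : P0 ≪ (Pstar : Measure 𝒳) := (InformationTheory.klDiv_ne_top_iff.1 hKL.ne).1
  refine ⟨15 * (L + 4), fun M hM => ?_⟩
  have hlim : Tendsto (fun n : ℕ => 2 * ENNReal.ofReal (1 / (n * ε n ^ 2)) +
      ENNReal.ofReal (4 * Real.exp (-(n * ε n ^ 2)))) atTop (𝓝 0) := by
    have h1 : Tendsto (fun w : ℝ => 2 * ENNReal.ofReal (1 / w) +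
        ENNReal.ofReal (4 * Real.exp (-w))) atTop (𝓝 0) := by
      have ha : Tendsto (fun w : ℝ => ENNReal.ofReal (1 / w)) atTop (𝓝 0) := by
        simpa using ENNReal.tendsto_ofReal (tendsto_const_nhds (x := (1 : ℝ)).div_atTop tendsto_id)
      have hb : Tendsto (fun w : ℝ => ENNReal.ofReal (4 * Real.exp (-w))) atTop (𝓝 0) := by
        simpa using ENNReal.tendsto_ofReal
          ((Real.tendsto_exp_atBot.comp tendsto_neg_atTop_atBot).const_mul 4)
      simpa using (ENNReal.Tendsto.const_mul ha (Or.inr ENNReal.ofNat_ne_top)).add hb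
    exact h1.comp hε_top
  refine tendsto_of_tendsto_of_tendsto_of_le_of_le' tendsto_const_nhds hlim
    (Eventually.of_forall fun _ => zero_le) ?_
  filter_upwards [eventually_ge_atTop 1, hε_top.eventually_ge_atTop 1] with n hn hw
  exact lintegral_posteriorMass_compl_ball_le μ 𝓜 h𝓜 m𝓜 p hp_meas hp prior P0 Pstar hac hn
    (hε_pos n hn) hL (hprior n hn) (hentropy n hn) hM hw
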